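/- Let $0<\Theta<\frac{\pi}{4}$ and $0<\delta<1$, and let $$D_\Theta=\{x+iy\in\mathbb C:\ 0<x<\pi,\ |y|<\tan\Theta\,\min(x,\pi-x)\}$$ be the open rhombus with vertices $0$, $\frac{\pi}{2}(1-i\tan\Theta)$, $\pi$, $\frac{\pi}{2}(1+i\tan\Theta)$. Put $\rho_\delta(s)=|s|^\delta|\pi-s|^\delta$, let $A^2_\delta(D_\Theta)$ be the space of holomorphic functions $f$ on $D_\Theta$ with $$\|f\|_{A^2_\delta(D_\Theta)}=\Big(\int_{D_\Theta}|f(s)|^2\rho_\delta(s)\,\mathrm dA(s)\Big)^{1/2}<\infty ,$$ where $\mathrm dA$ is the two-dimensional Lebesgue measure, and let $A^{1,2}_\delta(D_\Theta)=\{f\in A^2_\delta(D_\Theta):\ f'\in A^2_\delta(D_\Theta)\}$. Then the restriction to $(0,\pi)$ of every $f\in A^{1,2}_\delta(D_\Theta)$ lies in $L^2(0,\pi)$, hence is integrable, and the following hold. 1. There exists a constant $C>0$, depending only on $\Theta$ and $\delta$, such that every $f\in A^{1,2}_\delta(D_\Theta)$ satisfies $$\|f\|_{A^2_\delta(D_\Theta)}\le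 C\left(\|f'\|_{A^2_\delta(D_\Theta)}+\left|\int_0^\pi f(x)\,\mathrm dx\right|\right).$$ 2. The map $f\mapsto \|f'\|_{A^2_\delta(D_\Theta)}+\|f\|_{L^2(0,\pi)}$ is a norm on $A^{1,2}_\delta(D_\Theta)$, and it is equivalent to the norm $f\mapsto \|f\|_{A^2_\delta(D_\Theta)}+\|f'\|_{A^2_\delta(D_\Theta)}$. -/

import Mathlib

open MeasureTheory

noncomputable section

/-- The open rhombus `D_Θ` with vertices `0`, `(π/2)(1 - i tan Θ)`, `π`, `(π/2)(1 + i tan Θ)`. -/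
def rhombus (Θ : ℝ) : Set ℂ :=
  {s | 0 < s.re ∧ s.re < Real.pi ∧ |s.im| < Real.tan Θ * min s.re (Real.pi - s.re)}

theorem isOpen_rhombus (Θ : ℝ) : IsOpen (rhombus Θ) := by
  have h1 : IsOpen {s : ℂ | 0 < s.re} := isOpen_lt (by fun_prop) (by fun_prop)
  have h2 : IsOpen {s : ℂ | s.re < Real.pi} := isOpen_lt (by fun_prop) (by fun_prop)
  have h3 : IsOpen {s : ℂ | |s.im| < Real.tan Θ * min s.re (Real.pi - s.re)} :=
    isOpen_lt (by fun_prop) (by fun_prop)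
  exact h1.inter (h2.inter h3)

/-- The weight `ρ_δ(s) = |s|^δ |π - s|^δ`. -/
def rhoWeight (δ : ℝ) (s : ℂ) : ℝ := ‖s‖ ^ δ * ‖(Real.pi : ℂ) - s‖ ^ δ

theorem rhoWeight_nonneg (δ : ℝ) (s : ℂ) : 0 ≤ rhoWeight δ s := by
  unfold rhoWeight; positivity

theorem measurable_rhoWeight (δ : ℝ) : Measurable (rhoWeight δ) := by
  unfold rhoWeight; fun_prop

/-- The weighted Bergman space `A²_δ(D_Θ)`: the functions that are holomorphic on `D_Θ` and square
integrable there against `ρ_δ dA`. A function on `D_Θ` is represented by a function `ℂ → ℂ`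
whose values off `D_Θ` are irrelevant. -/
def bergman (Θ δ : ℝ) : Submodule ℂ (ℂ → ℂ) where
  carrier := {f | DifferentiableOn ℂ f (rhombus Θ) ∧
    IntegrableOn (fun s => ‖f s‖ ^ 2 * rhoWeight δ s) (rhombus Θ)}
  zero_mem' := ⟨differentiableOn_const 0, by simp⟩
  add_mem' := by
    rintro f g ⟨hf, hf2⟩ ⟨hg, hg2⟩
    refine ⟨hf.add hg, ?_⟩
    refine Integrable.mono' ((hf2.add hg2).const_mul 2) ?_ (Filter.Eventually.of_forall fun s => ?_)
    · have hc : AEStronglyMeasurable (fun s => (f + g) s) (volume.restrict (rhombus Θ)) :=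
        (hf.add hg).continuousOn.aestronglyMeasurable (isOpen_rhombus Θ).measurableSet
      exact (hc.norm.pow 2).mul (measurable_rhoWeight δ).aestronglyMeasurable
    · have hw := rhoWeight_nonneg δ s
      rw [Real.norm_of_nonneg (by positivity)]
      have h1 : ‖(f + g) s‖ ≤ ‖f s‖ + ‖g s‖ := norm_add_le _ _
      have h2 : ‖(f + g) s‖ ^ 2 ≤ 2 * (‖f s‖ ^ 2 + ‖g s‖ ^ 2) := by
        nlinarith [norm_nonneg ((f + g) s), sq_nonneg (‖f s‖ - ‖g s‖)]
      simp only [Pi.add_apply] at h2 ⊢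
      nlinarith [mul_le_mul_of_nonneg_right h2 hw]
  smul_mem' := by
    rintro c f ⟨hf, hf2⟩
    refine ⟨hf.const_smul c, ?_⟩
    have h := hf2.const_mul (‖c‖ ^ 2)
    refine h.congr (Filter.Eventually.of_forall fun s => ?_)
    simp only [Pi.smul_apply, norm_smul]
    ring

/-- The norm `‖f‖_{A²_δ(D_Θ)} = (∫_{D_Θ} |f|² ρ_δ dA)^{1/2}`. -/
def bergmanNorm (Θ δ : ℝ) (f : ℂ → ℂ) : ℝ :=
  Real.sqrt (∫ s in rhombus Θ, ‖f s‖ ^ 2 * rhoWeight δ s)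

theorem bergman_congr {Θ δ : ℝ} {f g : ℂ → ℂ} (hf : f ∈ bergman Θ δ)
    (h : Set.EqOn g f (rhombus Θ)) : g ∈ bergman Θ δ := by
  refine ⟨hf.1.congr h, hf.2.congr_fun (fun s hs => ?_) (isOpen_rhombus Θ).measurableSet⟩
  simp only [h hs]

/-- The weighted Bergman--Sobolev space
`A^{1,2}_δ(D_Θ) = {f ∈ A²_δ(D_Θ) | f' ∈ A²_δ(D_Θ)}`. -/
def bergmanSobolev (Θ δ : ℝ) : Submodule ℂ (ℂ → ℂ) where
  carrier := {f | f ∈ bergman Θ δ ∧ deriv f ∈ bergman Θ δ}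
  zero_mem' := by
    refine ⟨Submodule.zero_mem _, ?_⟩
    have h : deriv (0 : ℂ → ℂ) = 0 := by
      funext s
      exact deriv_const s 0
    rw [h]
    exact Submodule.zero_mem _
  add_mem' := by
    rintro f g ⟨hf, hf'⟩ ⟨hg, hg'⟩
    refine ⟨Submodule.add_mem _ hf hg, bergman_congr (Submodule.add_mem _ hf' hg') fun s hs => ?_⟩
    have hn := (isOpen_rhombus Θ).mem_nhds hs
    exact deriv_add (hf.1.differentiableAt hn) (hg.1.differentiableAt hn)
  smul_mem' := by
    rintro c f ⟨hf, hf'⟩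
    refine ⟨Submodule.smul_mem _ c hf, bergman_congr (Submodule.smul_mem _ c hf') fun s hs => ?_⟩
    exact deriv_const_smul c (hf.1.differentiableAt ((isOpen_rhombus Θ).mem_nhds hs))

/-- The norm of the trace of `f` on `(0, π)` in `L²(0, π)`. -/
def traceNorm (f : ℂ → ℂ) : ℝ :=
  Real.sqrt (∫ x in Set.Ioo 0 Real.pi, ‖f (x : ℂ)‖ ^ 2)

end

/-! Everything is compared with |f(π/2)| + ‖f'‖, the value at the centre plus the Bergman norm of
the derivative. Let m be the margin, which vanishes at the boundary like the distance to it. On a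
disc of radius m(w)/4 the weight is at least a constant times m(w)^δ, since one of the two vertices
0, π is always at distance at least π/2. The sub-mean value inequality then gives |g(w)| ≤ A
m(w)^(-1-δ/2) ‖g‖.

Applied to g = f' and integrated along the segment from π/2 to z, this yields |f(z) - f(π/2)| ≤ K
‖f'‖ m(z)^(-δ/2) (`exists_norm_sub_center_le`). The square of the right side is integrable both over
(0, π) and over the rhombus, because δ < 1. Hence the trace norm and the Bergman norm of f are
bounded by |f(π/2)| + ‖f'‖. Conversely, |f(π/2)| is controlled, modulo ‖f'‖, by the integral of f
over (0, π) or by its trace norm, and by ‖f‖ through point evaluation. Chaining these bounds proves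
the inequality and the equivalence of norms. -/

open scoped ENNReal

/-! ### Geometry of the rhombus and bounds on the weight -/

/-- A function measuring, up to a constant, the distance of `s` to the complement of the rhombus. -/
noncomputable def rhombusMargin (Θ : ℝ) (s : ℂ) : ℝ :=
  Real.tan Θ * min s.re (Real.pi - s.re) - |s.im|

theorem continuous_rhombusMargin (Θ : ℝ) : Continuous (rhombusMargin Θ) := by
  unfold rhombusMargin; fun_prop

/-- A positive margin forces the minimum to be positive, so the bounds on the real part come for
free. -/
theorem mem_rhombus_iff {Θ : ℝ} (hτ : 0 < Real.tan Θ) {s : ℂ} :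
    s ∈ rhombus Θ ↔ 0 < rhombusMargin Θ s := by
  simp only [rhombus, rhombusMargin, Set.mem_ofPred_eq]
  constructor
  · rintro ⟨-, -, h⟩; linarith
  · intro h
    have h1 : 0 < Real.tan Θ * min s.re (Real.pi - s.re) := by linarith [abs_nonneg s.im]
    have h2 := pos_of_mul_pos_right h1 hτ.le
    rw [lt_min_iff] at h2
    exact ⟨h2.1, by linarith [h2.2], by linarith⟩

/-- The minimum term contributes slope at most tan Θ ≤ 1 and the imaginary part slope 1, whence the
Lipschitz constant 2. It explains the radius m/4 used below: the margin then loses at most half. -/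
theorem rhombusMargin_le_add {Θ : ℝ} (hτ : 0 < Real.tan Θ) (hτ' : Real.tan Θ ≤ 1) (s w : ℂ) :
    rhombusMargin Θ w ≤ rhombusMargin Θ s + 2 * ‖s - w‖ := by
  have h1 : |s.re - w.re| ≤ ‖s - w‖ := by simpa using Complex.abs_re_le_norm (s - w)
  have h2 : |s.im - w.im| ≤ ‖s - w‖ := by simpa using Complex.abs_im_le_norm (s - w)
  have h3 : min w.re (Real.pi - w.re) ≤ min s.re (Real.pi - s.re) + ‖s - w‖ := by
    have := abs_le.mp h1
    rw [← min_add_add_right]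
    exact min_le_min (by linarith) (by linarith)
  have h4 : |s.im| ≤ |w.im| + ‖s - w‖ := by
    have := abs_sub_abs_le_abs_sub s.im w.im
    linarith
  have h5 : Real.tan Θ * min w.re (Real.pi - w.re) ≤
      Real.tan Θ * min s.re (Real.pi - s.re) + ‖s - w‖ := by
    have := mul_le_mul_of_nonneg_left h3 hτ.le
    nlinarith [norm_nonneg (s - w)]
  unfold rhombusMargin
  linarith

theorem half_rhombusMargin_le {Θ : ℝ} (hτ : 0 < Real.tan Θ) (hτ' : Real.tan Θ ≤ 1) {s w : ℂ}
    (hs : s ∈ Metric.closedBall w (rhombusMargin Θ w / 4)) :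
    rhombusMargin Θ w / 2 ≤ rhombusMargin Θ s := by
  have := rhombusMargin_le_add hτ hτ' s w
  rw [Metric.mem_closedBall, dist_eq_norm] at hs
  linarith

theorem closedBall_subset_rhombus {Θ : ℝ} (hτ : 0 < Real.tan Θ) (hτ' : Real.tan Θ ≤ 1) {w : ℂ}
    (hw : w ∈ rhombus Θ) : Metric.closedBall w (rhombusMargin Θ w / 4) ⊆ rhombus Θ := by
  intro s hs
  have := half_rhombusMargin_le hτ hτ' hs
  rw [mem_rhombus_iff hτ] at hw ⊢
  linarith

theorem rhombusMargin_le_norm {Θ : ℝ} (hτ : 0 < Real.tan Θ) (hτ' : Real.tan Θ ≤ 1) (s : ℂ) :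
    rhombusMargin Θ s ≤ ‖s‖ ∧ rhombusMargin Θ s ≤ ‖(Real.pi : ℂ) - s‖ := by
  constructor
  · have h2 : min s.re (Real.pi - s.re) ≤ ‖s‖ :=
      (min_le_left _ _).trans ((le_abs_self _).trans (Complex.abs_re_le_norm s))
    unfold rhombusMargin
    nlinarith [mul_le_mul_of_nonneg_left h2 hτ.le, norm_nonneg s, abs_nonneg s.im]
  · have h2 : min s.re (Real.pi - s.re) ≤ ‖(Real.pi : ℂ) - s‖ := by
      have := Complex.abs_re_le_norm ((Real.pi : ℂ) - s)
      simp only [Complex.sub_re, Complex.ofReal_re] at this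
      exact (min_le_right _ _).trans ((le_abs_self _).trans this)
    unfold rhombusMargin
    nlinarith [mul_le_mul_of_nonneg_left h2 hτ.le, norm_nonneg ((Real.pi : ℂ) - s),
      abs_nonneg s.im]

/-- The distances from s to 0 and to π add up to at least π, so one is at least π/2; the other is at
least the margin. -/
theorem le_rhoWeight {Θ δ : ℝ} (hτ : 0 < Real.tan Θ) (hτ' : Real.tan Θ ≤ 1) (hδ : 0 ≤ δ) {s : ℂ}
    (hs : s ∈ rhombus Θ) : rhombusMargin Θ s ^ δ * (Real.pi / 2) ^ δ ≤ rhoWeight δ s := by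
  obtain ⟨h1, h2⟩ := rhombusMargin_le_norm hτ hτ' s
  have h0 := (mem_rhombus_iff hτ).1 hs
  have hpi := Real.pi_pos
  have h3 : Real.pi ≤ ‖s‖ + ‖(Real.pi : ℂ) - s‖ := by
    have := norm_add_le s ((Real.pi : ℂ) - s)
    simpa [abs_of_pos hpi] using this
  unfold rhoWeight
  rcases le_total (Real.pi / 2) ‖s‖ with h | h
  · rw [mul_comm]
    gcongr
  · have : Real.pi / 2 ≤ ‖(Real.pi : ℂ) - s‖ := by linarith
    gcongr

theorem rhoWeight_le {Θ δ : ℝ} (hτ : 0 < Real.tan Θ) (hτ' : Real.tan Θ ≤ 1) (hδ : 0 ≤ δ) {s : ℂ}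
    (hs : s ∈ rhombus Θ) :
    rhoWeight δ s ≤ (2 * Real.pi) ^ δ * (2 * Real.pi) ^ δ := by
  obtain ⟨h1, h2, h3⟩ := hs
  have h4 : |s.im| ≤ Real.pi := by
    have : min s.re (Real.pi - s.re) ≤ Real.pi := (min_le_left _ _).trans h2.le
    have h5 := mul_le_mul_of_nonneg_left this hτ.le
    nlinarith [Real.pi_pos]
  have h5 : ‖s‖ ≤ 2 * Real.pi := by
    have := Complex.norm_le_abs_re_add_abs_im s
    rw [abs_of_pos h1] at this
    linarith
  have h6 : ‖(Real.pi : ℂ) - s‖ ≤ 2 * Real.pi := by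
    have := Complex.norm_le_abs_re_add_abs_im ((Real.pi : ℂ) - s)
    simp only [Complex.sub_re, Complex.ofReal_re, Complex.sub_im, Complex.ofReal_im, zero_sub,
      abs_neg] at this
    rw [abs_of_pos (by linarith : 0 < Real.pi - s.re)] at this
    linarith
  unfold rhoWeight
  gcongr

/-- The margin is concave along segments issuing from the centre `π / 2`. -/
theorem le_rhombusMargin_segment {Θ : ℝ} (hτ : 0 < Real.tan Θ) {z : ℂ} {t : ℝ}
    (ht0 : 0 ≤ t) :
    (1 - t) * (Real.tan Θ * (Real.pi / 2)) + t * rhombusMargin Θ z ≤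
      rhombusMargin Θ ((Real.pi / 2 : ℝ) + t * (z - (Real.pi / 2 : ℝ))) := by
  have h1 : ((Real.pi / 2 : ℝ) + t * (z - (Real.pi / 2 : ℝ)) : ℂ).re
      = Real.pi / 2 + t * (z.re - Real.pi / 2) := by
    rw [Complex.add_re, Complex.re_ofReal_mul, Complex.sub_re, Complex.ofReal_re]
  have h2 : ((Real.pi / 2 : ℝ) + t * (z - (Real.pi / 2 : ℝ)) : ℂ).im = t * z.im := by
    rw [Complex.add_im, Complex.im_ofReal_mul, Complex.sub_im, Complex.ofReal_im, sub_zero,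
      zero_add]
  unfold rhombusMargin
  rw [h1, h2, abs_mul, abs_of_nonneg ht0]
  have h3 : (1 - t) * (Real.pi / 2) + t * min z.re (Real.pi - z.re) ≤
      min (Real.pi / 2 + t * (z.re - Real.pi / 2))
        (Real.pi - (Real.pi / 2 + t * (z.re - Real.pi / 2))) := by
    refine le_min ?_ ?_
    · nlinarith [mul_le_mul_of_nonneg_left (min_le_left z.re (Real.pi - z.re)) ht0]
    · nlinarith [mul_le_mul_of_nonneg_left (min_le_right z.re (Real.pi - z.re)) ht0]
  nlinarith [mul_le_mul_of_nonneg_left h3 hτ.le]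

theorem rhombusMargin_le_center {Θ : ℝ} (hτ : 0 < Real.tan Θ) (z : ℂ) :
    rhombusMargin Θ z ≤ Real.tan Θ * (Real.pi / 2) := by
  have h : min z.re (Real.pi - z.re) ≤ Real.pi / 2 := by
    rcases le_total z.re (Real.pi / 2) with h | h
    · exact (min_le_left _ _).trans h
    · exact (min_le_right _ _).trans (by linarith)
  unfold rhombusMargin
  linarith [mul_le_mul_of_nonneg_left h hτ.le, abs_nonneg z.im]

theorem norm_sub_center_le {Θ : ℝ} (hτ : 0 < Real.tan Θ) (hτ' : Real.tan Θ ≤ 1) {s : ℂ}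
    (hs : s ∈ rhombus Θ) : ‖s - (Real.pi / 2 : ℝ)‖ ≤ Real.pi := by
  obtain ⟨h1, h2, h3⟩ := hs
  have h5 := Complex.norm_le_abs_re_add_abs_im (s - (Real.pi / 2 : ℝ))
  rw [Complex.sub_re, Complex.sub_im, Complex.ofReal_re, Complex.ofReal_im, sub_zero] at h5
  have h6 : |s.re - Real.pi / 2| ≤ Real.pi / 2 := abs_le.2 ⟨by linarith, by linarith⟩
  have h7 : min s.re (Real.pi - s.re) ≤ Real.pi / 2 := by
    rcases le_total s.re (Real.pi / 2) with h | h
    · exact (min_le_left _ _).trans h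
    · exact (min_le_right _ _).trans (by linarith)
  have h8 : |s.im| ≤ Real.pi / 2 := by
    have := mul_le_mul_of_nonneg_left h7 hτ.le
    nlinarith [Real.pi_pos]
  linarith

theorem rhombusMargin_ofReal (Θ x : ℝ) :
    rhombusMargin Θ (x : ℂ) = Real.tan Θ * min x (Real.pi - x) := by
  simp [rhombusMargin]

theorem ofReal_mem_rhombus {Θ : ℝ} (hτ : 0 < Real.tan Θ) {x : ℝ}
    (hx : x ∈ Set.Ioo 0 Real.pi) : (x : ℂ) ∈ rhombus Θ := by
  rw [mem_rhombus_iff hτ, rhombusMargin_ofReal]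
  exact mul_pos hτ (lt_min hx.1 (by linarith [hx.2]))

/-! ### Mean value inequalities -/

/-- The mean value property on a circle, as an inequality between lower integrals. -/
theorem enorm_center_le_lintegral_circle {U : Set ℂ} {h : ℂ → ℂ}
    (hh : DifferentiableOn ℂ h U) {w : ℂ} {r : ℝ} (hr : 0 < r)
    (hU : Metric.closedBall w r ⊆ U) :
    ENNReal.ofReal (2 * Real.pi) * ‖h w‖ₑ ≤
      ∫⁻ θ in Set.Ioo (-Real.pi) Real.pi, ‖h (circleMap w r θ)‖ₑ := by
  have hd : DiffContOnCl ℂ h (Metric.ball w |r|) := by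
    rw [abs_of_pos hr]
    refine (hh.mono ?_).diffContOnCl
    rwa [closure_ball w hr.ne']
  have h1 := hd.circleAverage
  rw [Real.circleAverage_def] at h1
  -- Periodicity moves the angles to (-π, π), the range used by polar coordinates.
  have hp : Function.Periodic (fun θ => h (circleMap w r θ)) (2 * Real.pi) := fun θ => by
    simp only [periodic_circleMap w r θ]
  have h2 := hp.intervalIntegral_add_eq 0 (-Real.pi)
  rw [zero_add, show -Real.pi + 2 * Real.pi = Real.pi by ring] at h2
  rw [h2, intervalIntegral.integral_of_le (by linarith [Real.pi_pos])] at h1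
  have h3 : ∫ θ in Set.Ioc (-Real.pi) Real.pi, h (circleMap w r θ) = (2 * Real.pi : ℝ) • h w := by
    rw [← h1, smul_smul, mul_inv_cancel₀ (by positivity), one_smul]
  calc ENNReal.ofReal (2 * Real.pi) * ‖h w‖ₑ = ‖(2 * Real.pi : ℝ) • h w‖ₑ := by
        rw [enorm_smul, Real.enorm_eq_ofReal (by positivity)]
    _ = ‖∫ θ in Set.Ioc (-Real.pi) Real.pi, h (circleMap w r θ)‖ₑ := by rw [h3]
    _ ≤ ∫⁻ θ in Set.Ioc (-Real.pi) Real.pi, ‖h (circleMap w r θ)‖ₑ :=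
        enorm_integral_le_lintegral_enorm _
    _ = _ := setLIntegral_congr Ioo_ae_eq_Ioc.symm

/-- The mean value property on a disc, as an inequality between lower integrals. -/
theorem enorm_center_le_lintegral_ball {U : Set ℂ} {h : ℂ → ℂ}
    (hh : DifferentiableOn ℂ h U) {w : ℂ} {R : ℝ} (hR : 0 < R)
    (hU : Metric.closedBall w R ⊆ U) :
    ENNReal.ofReal (Real.pi * R ^ 2) * ‖h w‖ₑ ≤ ∫⁻ s in Metric.ball w R, ‖h s‖ₑ := by
  -- As h is arbitrary off U, cutting off to the disc is what makes the integrand measurable on the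
  -- whole plane, as polar coordinates and Tonelli require.
  set F : ℂ → ℝ≥0∞ := (Metric.ball w R).indicator (fun s => ‖h s‖ₑ) with hF
  have hball : Metric.ball w R ⊆ U := Metric.ball_subset_closedBall.trans hU
  have hcont : ContinuousOn (fun s => ‖h s‖ₑ) (Metric.ball w R) :=
    (hh.continuousOn.mono hball).enorm
  have hFm : Measurable F := by
    refine measurable_of_restrict_of_restrict_compl
      (Metric.isOpen_ball (x := w) (ε := R)).measurableSet ?_ ?_
    · have : (Metric.ball w R).domRestrict F = (Metric.ball w R).domRestrict (fun s => ‖h s‖ₑ) := by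
        exact funext fun s => Set.indicator_of_mem s.2 fun s => ‖h s‖ₑ
      rw [this]
      exact (continuousOn_iff_continuous_domRestrict.1 hcont).measurable
    · have : (Metric.ball w R)ᶜ.domRestrict F = fun _ => 0 := by
        exact funext fun s => Set.indicator_of_notMem s.2 fun s => ‖h s‖ₑ
      rw [this]
      exact measurable_const
  rw [← lintegral_indicator Metric.isOpen_ball.measurableSet, ← hF,
    ← lintegral_add_left_eq_self F w, ← Complex.lintegral_comp_polarCoord_symm,
    polarCoord_target, Measure.volume_eq_prod, ← Measure.prod_restrict]
  have hm : Measurable fun p : ℝ × ℝ =>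
      ENNReal.ofReal p.1 • F (w + Complex.polarCoord.symm p) := by
    have : Measurable fun p : ℝ × ℝ => Complex.polarCoord.symm p := by
      simp only [Complex.polarCoord_symm_apply]
      fun_prop
    simp only [smul_eq_mul]
    exact (ENNReal.measurable_ofReal.comp measurable_fst).mul
      (hFm.comp (measurable_const.add this))
  rw [lintegral_prod _ hm.aemeasurable]
  calc ENNReal.ofReal (Real.pi * R ^ 2) * ‖h w‖ₑ
      = ∫⁻ r in Set.Ioo 0 R, ENNReal.ofReal r * (ENNReal.ofReal (2 * Real.pi) * ‖h w‖ₑ) := by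
        rw [lintegral_mul_const _ ENNReal.measurable_ofReal, ← mul_assoc]
        congr 1
        have h1 : ∫⁻ r in Set.Ioo 0 R, ENNReal.ofReal r = ENNReal.ofReal (R ^ 2 / 2) := by
          rw [setLIntegral_congr Ioo_ae_eq_Ioc, ← ofReal_integral_eq_lintegral_ofReal,
            ← intervalIntegral.integral_of_le hR.le, integral_id]
          · simp
          · exact (continuous_id.integrableOn_Icc).mono_set Set.Ioc_subset_Icc_self
          · filter_upwards [ae_restrict_mem measurableSet_Ioc] with r hr using hr.1.le
        rw [h1, ← ENNReal.ofReal_mul (by positivity)]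
        congr 1
        ring
    _ ≤ ∫⁻ r in Set.Ioo 0 R, ∫⁻ θ in Set.Ioo (-Real.pi) Real.pi,
          ENNReal.ofReal r • F (w + Complex.polarCoord.symm (r, θ)) := by
        refine setLIntegral_mono' measurableSet_Ioo fun r hr => ?_
        have h1 := enorm_center_le_lintegral_circle hh hr.1
          ((Metric.closedBall_subset_closedBall hr.2.le).trans hU)
        have h2 : ∀ θ, F (w + Complex.polarCoord.symm (r, θ)) = ‖h (circleMap w r θ)‖ₑ := by
          intro θ
          have h3 : w + Complex.polarCoord.symm (r, θ) = circleMap w r θ := by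
            rw [Complex.polarCoord_symm_apply, circleMap, Complex.exp_mul_I]
            push_cast
            rfl
          rw [h3, hF, Set.indicator_of_mem]
          rw [Metric.mem_ball, dist_eq_norm, circleMap_sub_center, norm_circleMap_zero,
            abs_of_pos hr.1]
          exact hr.2
        simp only [h2, smul_eq_mul]
        rw [lintegral_const_mul' _ _ ENNReal.ofReal_ne_top]
        gcongr
    _ ≤ _ := lintegral_mono_set Set.Ioo_subset_Ioi_self

/-- The sub-mean value inequality for the square modulus of a holomorphic function. -/
theorem sq_norm_center_le_integral_ball {U : Set ℂ} {g : ℂ → ℂ}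
    (hg : DifferentiableOn ℂ g U) {w : ℂ} {R : ℝ} (hR : 0 < R)
    (hU : Metric.closedBall w R ⊆ U) :
    Real.pi * R ^ 2 * ‖g w‖ ^ 2 ≤ ∫ s in Metric.ball w R, ‖g s‖ ^ 2 := by
  have hint : IntegrableOn (fun s => ‖g s‖ ^ 2) (Metric.ball w R) := by
    refine IntegrableOn.mono_set ?_ Metric.ball_subset_closedBall
    exact ((hg.continuousOn.mono hU).norm.pow 2).integrableOn_compact
      (isCompact_closedBall w R)
  -- The square of g is itself holomorphic, so no convexity argument is needed.
  have h := enorm_center_le_lintegral_ball (hg.pow 2) hR hU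
  have h1 : ∀ s, ‖(g ^ 2) s‖ₑ = ENNReal.ofReal (‖g s‖ ^ 2) := fun s => by
    rw [← ofReal_norm, Pi.pow_apply, norm_pow]
  simp only [h1] at h
  rw [← ENNReal.ofReal_mul (by positivity),
    ← ofReal_integral_eq_lintegral_ofReal hint (Filter.Eventually.of_forall fun _ => by positivity)]
    at h
  exact (ENNReal.ofReal_le_ofReal_iff (by positivity)).1 h

/-! ### Pointwise growth and oscillation -/

theorem sq_bergmanNorm (Θ δ : ℝ) (f : ℂ → ℂ) :
    bergmanNorm Θ δ f ^ 2 = ∫ s in rhombus Θ, ‖f s‖ ^ 2 * rhoWeight δ s :=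
  Real.sq_sqrt (integral_nonneg fun s => mul_nonneg (by positivity) (rhoWeight_nonneg δ s))

theorem bergmanNorm_nonneg (Θ δ : ℝ) (f : ℂ → ℂ) : 0 ≤ bergmanNorm Θ δ f := Real.sqrt_nonneg _

/-- Point evaluations on the weighted Bergman space, with the growth rate at the boundary. -/
theorem exists_norm_le_rhombusMargin_rpow_mul_bergmanNorm {Θ δ : ℝ} (hτ : 0 < Real.tan Θ)
    (hτ' : Real.tan Θ ≤ 1) (hδ : 0 ≤ δ) :
    ∃ A : ℝ, 0 < A ∧ ∀ g ∈ bergman Θ δ, ∀ w ∈ rhombus Θ,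
      ‖g w‖ ≤ A * rhombusMargin Θ w ^ (-(1 + δ / 2)) * bergmanNorm Θ δ g := by
  have hpi := Real.pi_pos
  -- The area π(m/4)² times the lower bound (m/2)^δ (π/2)^δ for the weight, with the power m^(2+δ)
  -- removed.
  set D : ℝ := Real.pi / 16 * (Real.pi / 4) ^ δ with hD
  have hD0 : 0 < D := by positivity
  refine ⟨Real.sqrt D⁻¹, by positivity, fun g hg w hw => ?_⟩
  set m := rhombusMargin Θ w with hm
  have hm0 : 0 < m := (mem_rhombus_iff hτ).1 hw
  have hsub := closedBall_subset_rhombus hτ hτ' hw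
  have h1 := sq_norm_center_le_integral_ball hg.1 (by positivity : 0 < m / 4) hsub
  have hsub' : Metric.ball w (m / 4) ⊆ rhombus Θ := Metric.ball_subset_closedBall.trans hsub
  set q : ℝ := m ^ δ * (Real.pi / 4) ^ δ with hq
  have hq0 : 0 < q := by positivity
  have h2 : q * ∫ s in Metric.ball w (m / 4), ‖g s‖ ^ 2 ≤ bergmanNorm Θ δ g ^ 2 := by
    rw [sq_bergmanNorm, ← integral_const_mul]
    calc ∫ s in Metric.ball w (m / 4), q * ‖g s‖ ^ 2
        ≤ ∫ s in Metric.ball w (m / 4), ‖g s‖ ^ 2 * rhoWeight δ s := by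
          refine setIntegral_mono_on ?_ (hg.2.mono_set hsub') Metric.isOpen_ball.measurableSet
            fun s hs => ?_
          · refine Integrable.const_mul (IntegrableOn.mono_set ?_ Metric.ball_subset_closedBall) q
            exact ((hg.1.continuousOn.mono hsub).norm.pow 2).integrableOn_compact
              (isCompact_closedBall w _)
          · have h3 := le_rhoWeight hτ hτ' hδ (hsub' hs)
            have h4 := half_rhombusMargin_le hτ hτ' (Metric.ball_subset_closedBall hs)
            rw [← hm] at h4
            have h5 : q = (m / 2) ^ δ * (Real.pi / 2) ^ δ := by
              rw [hq, ← Real.mul_rpow hm0.le (by positivity),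
                ← Real.mul_rpow (by positivity) (by positivity)]
              congr 1
              ring
            have h6 : q ≤ rhoWeight δ s := by
              rw [h5]
              refine le_trans ?_ h3
              gcongr
            rw [mul_comm]
            gcongr
      _ ≤ ∫ s in rhombus Θ, ‖g s‖ ^ 2 * rhoWeight δ s :=
          setIntegral_mono_set hg.2
            (Filter.Eventually.of_forall fun s => mul_nonneg (by positivity) (rhoWeight_nonneg δ s))
            hsub'.eventuallyLE
  have h3 : D * (m ^ (1 + δ / 2) * ‖g w‖) ^ 2 ≤ bergmanNorm Θ δ g ^ 2 := by
    refine le_trans ?_ ((mul_le_mul_of_nonneg_left h1 hq0.le).trans h2)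
    have : (m ^ (1 + δ / 2)) ^ 2 = m ^ 2 * m ^ δ := by
      rw [← Real.rpow_natCast, ← Real.rpow_mul hm0.le, ← Real.rpow_natCast,
        ← Real.rpow_add hm0]
      congr 1
      push_cast
      ring
    rw [mul_pow, this, hD, hq]
    apply le_of_eq
    ring
  have h4 : m ^ (1 + δ / 2) * ‖g w‖ ≤ Real.sqrt D⁻¹ * bergmanNorm Θ δ g := by
    refine le_of_sq_le_sq ?_ (by have := bergmanNorm_nonneg Θ δ g; positivity)
    rw [mul_pow (Real.sqrt _), Real.sq_sqrt (by positivity), inv_mul_eq_div, le_div_iff₀ hD0]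
    linarith
  rw [Real.rpow_neg hm0.le, mul_right_comm, ← div_eq_mul_inv, le_div_iff₀ (by positivity)]
  linarith

/-- Oscillation from the centre, controlled by the Bergman norm of the derivative. -/
theorem exists_norm_sub_center_le {Θ δ : ℝ} (hτ : 0 < Real.tan Θ)
    (hτ' : Real.tan Θ ≤ 1) (hδ : 0 < δ) :
    ∃ K : ℝ, 0 < K ∧ ∀ f ∈ bergmanSobolev Θ δ, ∀ z ∈ rhombus Θ,
      ‖f z - f ((Real.pi / 2 : ℝ) : ℂ)‖ ≤
        K * bergmanNorm Θ δ (deriv f) * rhombusMargin Θ z ^ (-(δ / 2)) := by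
  obtain ⟨A, hA, hAb⟩ :=
    exists_norm_le_rhombusMargin_rpow_mul_bergmanNorm (δ := δ) hτ hτ' hδ.le
  have hpi := Real.pi_pos
  set M : ℝ := Real.tan Θ * (Real.pi / 2) with hM
  have hM0 : 0 < M := by positivity
  set a : ℝ := 1 + δ / 2 with ha
  -- Here π bounds the length of the segment, 2^a pays for the half in `hseg`, and M(δ/2) comes from
  -- integrating ((1 - t)M + μ)^(-a).
  refine ⟨Real.pi * A * 2 ^ a / (M * (δ / 2)), by positivity, fun f hf z hz => ?_⟩
  have hN := bergmanNorm_nonneg Θ δ (deriv f)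
  set N := bergmanNorm Θ δ (deriv f)
  have hμ0 : 0 < rhombusMargin Θ z := (mem_rhombus_iff hτ).1 hz
  have hμM := rhombusMargin_le_center hτ z
  set μ := rhombusMargin Θ z with hμ
  set c : ℂ := ((Real.pi / 2 : ℝ) : ℂ) with hc
  set γ : ℝ → ℂ := fun t => c + t * (z - c) with hγ
  -- Concavity gives (1 - t)M + tμ, which exceeds the bound wanted by ((1 - t)(M - μ) + tμ)/2 ≥ 0.
  -- The weaker form has slope proportional to M, independent of z, so integration does not
  -- degenerate when μ is close to M.
  have hseg : ∀ t ∈ Set.Icc (0 : ℝ) 1, ((1 - t) * M + μ) / 2 ≤ rhombusMargin Θ (γ t) := by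
    intro t ht
    refine le_trans ?_ (le_rhombusMargin_segment (z := z) hτ ht.1)
    rw [← hM, ← hμ]
    nlinarith [mul_nonneg ht.1 hμ0.le, mul_nonneg (sub_nonneg.2 ht.2) (sub_nonneg.2 hμM)]
  have hpos : ∀ t ∈ Set.Icc (0 : ℝ) 1, 0 < (1 - t) * M + μ := fun t ht => by
    nlinarith [mul_nonneg (sub_nonneg.2 ht.2) hM0.le]
  have hmem : ∀ t ∈ Set.Icc (0 : ℝ) 1, γ t ∈ rhombus Θ := fun t ht => by
    rw [mem_rhombus_iff hτ]
    linarith [hseg t ht, hpos t ht]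
  have hγd : ∀ t : ℝ, HasDerivAt γ (z - c) t := fun t => by
    have h1 : HasDerivAt (fun t : ℝ => (t : ℂ)) 1 t := Complex.ofRealCLM.hasDerivAt
    have h2 := (h1.mul_const (z - c)).const_add c
    rwa [one_mul] at h2
  have hFd : ∀ t ∈ Set.Icc (0 : ℝ) 1,
      HasDerivAt (fun t => f (γ t) - f c) (deriv f (γ t) * (z - c)) t := fun t ht => by
    have h1 := (hf.1.1.differentiableAt ((isOpen_rhombus Θ).mem_nhds (hmem t ht))).hasDerivAt
    exact (h1.comp t (hγd t)).sub_const _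
  -- A majorant whose derivative dominates that of f along the segment; its value at t = 1 is the
  -- claimed bound.
  set B : ℝ → ℝ := fun t =>
    Real.pi * A * 2 ^ a / (M * (δ / 2)) * N * ((1 - t) * M + μ) ^ (-(δ / 2)) with hB
  have hBd : ∀ t ∈ Set.Icc (0 : ℝ) 1,
      HasDerivAt B (Real.pi * A * 2 ^ a * N * ((1 - t) * M + μ) ^ (-a)) t := fun t ht => by
    have h1 : HasDerivAt (fun t : ℝ => (1 - t) * M + μ) (-1 * M) t :=
      (((hasDerivAt_id t).const_sub 1).mul_const M).add_const μ
    have h2 := (h1.rpow_const (p := -(δ / 2)) (Or.inl (hpos t ht).ne')).const_mul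
      (Real.pi * A * 2 ^ a / (M * (δ / 2)) * N)
    refine h2.congr_deriv ?_
    rw [show -(δ / 2) - 1 = -a by rw [ha]; ring]
    field_simp
  have key := image_norm_le_of_norm_deriv_right_le_deriv_boundary'
    (f := fun t => f (γ t) - f c) (f' := fun t => deriv f (γ t) * (z - c)) (a := 0) (b := 1)
    (B := B) (B' := fun t => Real.pi * A * 2 ^ a * N * ((1 - t) * M + μ) ^ (-a))
    (fun t ht => (hFd t ht).continuousAt.continuousWithinAt)
    (fun t ht => (hFd t (Set.Ico_subset_Icc_self ht)).hasDerivWithinAt)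
    (by
      have h0 := hpos 0 (by simp)
      simp only [hγ, hB, Complex.ofReal_zero, zero_mul, add_zero, sub_self, norm_zero]
      positivity)
    (fun t ht => (hBd t ht).continuousAt.continuousWithinAt)
    (fun t ht => (hBd t (Set.Ico_subset_Icc_self ht)).hasDerivWithinAt)
    (fun t ht => by
      replace ht := Set.Ico_subset_Icc_self ht
      have h0 := hpos t ht
      have h1 := hAb _ hf.2 _ (hmem t ht)
      have h2 : rhombusMargin Θ (γ t) ^ (-a) ≤ 2 ^ a * ((1 - t) * M + μ) ^ (-a) := by
        calc rhombusMargin Θ (γ t) ^ (-a) ≤ (((1 - t) * M + μ) / 2) ^ (-a) :=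
              Real.rpow_le_rpow_of_nonpos (by positivity) (hseg t ht) (by rw [ha]; linarith)
          _ = _ := by
              rw [Real.div_rpow h0.le (by norm_num), Real.rpow_neg (by norm_num : (0:ℝ) ≤ 2),
                div_inv_eq_mul, mul_comm]
      have h3 := norm_sub_center_le hτ hτ' hz
      rw [norm_mul]
      calc ‖deriv f (γ t)‖ * ‖z - c‖
          ≤ (A * (2 ^ a * ((1 - t) * M + μ) ^ (-a)) * N) * Real.pi := by
            refine mul_le_mul (h1.trans ?_) h3 (norm_nonneg _) (by positivity)
            gcongr
        _ = _ := by ring)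
    (Set.right_mem_Icc.2 zero_le_one)
  simpa [hγ, hB] using key

/-! ### Integrability of negative powers of the margin -/

theorem integrableOn_Ioo_rhombusMargin_rpow {Θ a : ℝ} (hτ : 0 < Real.tan Θ) (ha : a < 1) :
    IntegrableOn (fun x : ℝ => rhombusMargin Θ x ^ (-a)) (Set.Ioo 0 Real.pi) := by
  have h1 : IntervalIntegrable (fun x : ℝ => x ^ (-a)) volume 0 Real.pi :=
    intervalIntegral.intervalIntegrable_rpow' (by linarith)
  have h2 : IntervalIntegrable (fun x : ℝ => (Real.pi - x) ^ (-a)) volume 0 Real.pi := by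
    have := (h1.comp_sub_left Real.pi).symm
    simpa using this
  have h3 := (h1.add h2).const_mul (Real.tan Θ ^ (-a))
  rw [intervalIntegrable_iff_integrableOn_Ioo_of_le Real.pi_pos.le] at h3
  refine Integrable.mono' h3 ?_ ?_
  · have : Measurable fun x : ℝ => rhombusMargin Θ x ^ (-a) :=
      ((continuous_rhombusMargin Θ).measurable.comp Complex.measurable_ofReal).pow_const _
    exact this.aestronglyMeasurable
  · filter_upwards [ae_restrict_mem measurableSet_Ioo] with x hx
    have hx' : 0 < Real.pi - x := by linarith [hx.2]
    have hx0 := hx.1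
    have hmin : 0 < min x (Real.pi - x) := lt_min hx.1 hx'
    rw [rhombusMargin_ofReal, Real.norm_of_nonneg (by positivity),
      Real.mul_rpow hτ.le hmin.le]
    refine mul_le_mul_of_nonneg_left ?_ (by positivity)
    rcases min_choice x (Real.pi - x) with h | h <;> rw [h]
    · exact le_add_of_nonneg_right (by positivity)
    · exact le_add_of_nonneg_left (by positivity)

/-- On a vertical line the margin is T(x) - y or T(x) + y. Adding both choices and translating in y
bounds the inner integral by twice that of u^(-a) over (0, 2π), uniformly in x; Tonelli finishes. -/
theorem integrableOn_rhombus_rhombusMargin_rpow {Θ a : ℝ} (hτ : 0 < Real.tan Θ)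
    (hτ' : Real.tan Θ ≤ 1) (ha : a < 1) :
    IntegrableOn (fun s : ℂ => rhombusMargin Θ s ^ (-a)) (rhombus Θ) := by
  have hpi := Real.pi_pos
  have hmeas : Measurable fun s : ℂ => rhombusMargin Θ s ^ (-a) :=
    (continuous_rhombusMargin Θ).measurable.pow_const _
  refine ⟨hmeas.aestronglyMeasurable, ?_⟩
  -- The margin never exceeds π on the rhombus; the endpoint 2π merely leaves room for a strict
  -- inequality.
  set G : ℝ → ℝ≥0∞ := (Set.Ioo 0 (2 * Real.pi)).indicator fun u => ENNReal.ofReal (u ^ (-a))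
    with hG
  have hGm : Measurable G :=
    (ENNReal.measurable_ofReal.comp (measurable_id.pow_const _)).indicator measurableSet_Ioo
  have hGfin : ∫⁻ u, G u < ∞ := by
    rw [hG, lintegral_indicator measurableSet_Ioo]
    have h1 : IntervalIntegrable (fun x : ℝ => x ^ (-a)) volume 0 (2 * Real.pi) :=
      intervalIntegral.intervalIntegrable_rpow' (by linarith)
    rw [intervalIntegrable_iff_integrableOn_Ioo_of_le (by positivity)] at h1
    exact h1.lintegral_lt_top
  set T : ℝ → ℝ := fun x => Real.tan Θ * min x (Real.pi - x) with hT
  have hTm : Measurable T := by fun_prop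
  set H : ℝ × ℝ → ℝ≥0∞ := fun p => (Set.Ioo 0 Real.pi).indicator 1 p.1 *
    (G (T p.1 - p.2) + G (p.2 - -T p.1)) with hH
  have hHm : Measurable H := by
    refine ((measurable_one.indicator measurableSet_Ioo).comp measurable_fst).mul ?_
    refine (hGm.comp ?_).add (hGm.comp ?_)
    · exact (hTm.comp measurable_fst).sub measurable_snd
    · exact measurable_snd.sub (hTm.comp measurable_fst).neg
  have hle : ∀ s ∈ rhombus Θ, ‖rhombusMargin Θ s ^ (-a)‖ₑ ≤ H (s.re, s.im) := by
    intro s hs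
    have hm0 := (mem_rhombus_iff hτ).1 hs
    have hm : rhombusMargin Θ s = T s.re - |s.im| := rfl
    have hTle : T s.re ≤ Real.pi := (rhombusMargin_le_center hτ (s.re : ℂ)).trans' (by
      rw [rhombusMargin_ofReal]) |>.trans (by nlinarith)
    have hre : s.re ∈ Set.Ioo 0 Real.pi := ⟨hs.1, hs.2.1⟩
    rw [Real.enorm_eq_ofReal (by positivity)]
    simp only [hH, Set.indicator_of_mem hre, Pi.one_apply, one_mul]
    have hin : rhombusMargin Θ s ∈ Set.Ioo 0 (2 * Real.pi) :=
      ⟨hm0, by linarith [abs_nonneg s.im]⟩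
    have hGe : G (rhombusMargin Θ s) = ENNReal.ofReal (rhombusMargin Θ s ^ (-a)) :=
      Set.indicator_of_mem hin _
    rw [← hGe, hm]
    rcases abs_choice s.im with h | h <;> rw [h]
    · exact le_self_add
    · rw [sub_neg_eq_add, sub_neg_eq_add, add_comm s.im]
      exact le_add_self
  have hHfin : ∫⁻ p, H p < ∞ := by
    rw [Measure.volume_eq_prod, lintegral_prod _ hHm.aemeasurable]
    have hinner : ∀ x, ∫⁻ y, H (x, y) =
        (Set.Ioo 0 Real.pi).indicator 1 x * (2 * ∫⁻ u, G u) := by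
      intro x
      simp only [hH]
      rw [lintegral_const_mul, lintegral_add_left, lintegral_sub_left_eq_self,
        lintegral_sub_right_eq_self, two_mul]
      · exact hGm.comp (measurable_const.sub measurable_id)
      · exact (hGm.comp (measurable_const.sub measurable_id)).add
          (hGm.comp (measurable_id.sub measurable_const))
    simp only [hinner]
    rw [lintegral_mul_const _ (measurable_one.indicator measurableSet_Ioo),
      lintegral_indicator_one measurableSet_Ioo]
    exact ENNReal.mul_lt_top (by simp) (ENNReal.mul_lt_top (by simp) hGfin)
  calc ∫⁻ s in rhombus Θ, ‖rhombusMargin Θ s ^ (-a)‖ₑ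
      ≤ ∫⁻ s in rhombus Θ, H (s.re, s.im) :=
        setLIntegral_mono' (isOpen_rhombus Θ).measurableSet hle
    _ ≤ ∫⁻ s : ℂ, H (Complex.measurableEquivRealProd s) := setLIntegral_le_lintegral _ _
    _ = ∫⁻ p, H p := Complex.volume_preserving_equiv_real_prod.lintegral_comp hHm
    _ < ∞ := hHfin

/-! ### Comparison with the value at the centre -/

theorem sq_traceNorm (f : ℂ → ℂ) :
    traceNorm f ^ 2 = ∫ x in Set.Ioo 0 Real.pi, ‖f (x : ℂ)‖ ^ 2 :=
  Real.sq_sqrt (integral_nonneg fun _ => by positivity)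

theorem traceNorm_nonneg (f : ℂ → ℂ) : 0 ≤ traceNorm f := Real.sqrt_nonneg _

theorem aestronglyMeasurable_trace {Θ : ℝ} (hτ : 0 < Real.tan Θ) {f : ℂ → ℂ}
    (hf : DifferentiableOn ℂ f (rhombus Θ)) :
    AEStronglyMeasurable (fun x : ℝ => f (x : ℂ)) (volume.restrict (Set.Ioo 0 Real.pi)) :=
  (hf.continuousOn.comp Complex.continuous_ofReal.continuousOn fun _ hx =>
    ofReal_mem_rhombus hτ hx).aestronglyMeasurable measurableSet_Ioo

theorem center_mem_rhombus {Θ : ℝ} (hτ : 0 < Real.tan Θ) :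
    ((Real.pi / 2 : ℝ) : ℂ) ∈ rhombus Θ :=
  ofReal_mem_rhombus hτ ⟨by linarith [Real.pi_pos], by linarith [Real.pi_pos]⟩

theorem volume_rhombus_lt_top {Θ : ℝ} (hτ : 0 < Real.tan Θ) (hτ' : Real.tan Θ ≤ 1) :
    volume (rhombus Θ) < ∞ := by
  refine (measure_mono fun s hs => ?_).trans_lt
    (measure_closedBall_lt_top (x := ((Real.pi / 2 : ℝ) : ℂ)) (r := Real.pi))
  rw [Metric.mem_closedBall, dist_eq_norm]
  exact norm_sub_center_le hτ hτ' hs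

/-- Squaring turns the oscillation exponent -δ/2 into -δ, integrable for δ < 1. It serves with u and
v in either role, to bound f by its central value or the reverse. -/
theorem sq_norm_le_of_norm_sub_le {u v : ℂ} {k m δ : ℝ} (hm : 0 < m)
    (h : ‖u - v‖ ≤ k * m ^ (-(δ / 2))) : ‖u‖ ^ 2 ≤ 2 * ‖v‖ ^ 2 + 2 * k ^ 2 * m ^ (-δ) := by
  have h1 : (m ^ (-(δ / 2))) ^ 2 = m ^ (-δ) := by
    rw [← Real.rpow_natCast, ← Real.rpow_mul hm.le]
    congr 1
    push_cast
    ring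
  have h2 : ‖u‖ ≤ ‖v‖ + ‖u - v‖ := by simpa using norm_add_le v (u - v)
  have h3 : ‖u - v‖ ^ 2 ≤ k ^ 2 * m ^ (-δ) := by
    rw [← h1, ← mul_pow]
    exact pow_le_pow_left₀ (norm_nonneg _) h 2
  have h4 : ‖u‖ ^ 2 ≤ (‖v‖ + ‖u - v‖) ^ 2 := pow_le_pow_left₀ (norm_nonneg _) h2 2
  nlinarith [sq_nonneg (‖v‖ - ‖u - v‖)]

/-- The square of √a + √b + 1 dominates both a and b; the summand 1 keeps the constant positive. -/
theorem le_mul_add_of_sq_le {x v n a b : ℝ} (hv : 0 ≤ v) (hn : 0 ≤ n) (ha : 0 ≤ a) (hb : 0 ≤ b)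
    (h : x ^ 2 ≤ a * v ^ 2 + b * n ^ 2) :
    x ≤ (Real.sqrt a + Real.sqrt b + 1) * (v + n) := by
  refine le_of_sq_le_sq (h.trans ?_) (by positivity)
  have h1 : a ≤ (Real.sqrt a + Real.sqrt b + 1) ^ 2 := by
    nlinarith [Real.sq_sqrt ha, Real.sqrt_nonneg a, Real.sqrt_nonneg b]
  have h2 : b ≤ (Real.sqrt a + Real.sqrt b + 1) ^ 2 := by
    nlinarith [Real.sq_sqrt hb, Real.sqrt_nonneg a, Real.sqrt_nonneg b]
  calc a * v ^ 2 + b * n ^ 2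
      ≤ (Real.sqrt a + Real.sqrt b + 1) ^ 2 * v ^ 2
        + (Real.sqrt a + Real.sqrt b + 1) ^ 2 * n ^ 2 := by gcongr
    _ = (Real.sqrt a + Real.sqrt b + 1) ^ 2 * (v ^ 2 + n ^ 2) := by ring
    _ ≤ (Real.sqrt a + Real.sqrt b + 1) ^ 2 * (v + n) ^ 2 := by
        gcongr
        nlinarith [mul_nonneg hv hn]
    _ = _ := by ring

theorem memLp_trace {Θ δ : ℝ} (hτ : 0 < Real.tan Θ) (hτ' : Real.tan Θ ≤ 1) (hδ₀ : 0 < δ)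
    (hδ₁ : δ < 1) {f : ℂ → ℂ} (hf : f ∈ bergmanSobolev Θ δ) :
    MemLp (fun x : ℝ => f (x : ℂ)) 2 (volume.restrict (Set.Ioo 0 Real.pi)) := by
  obtain ⟨K, -, hK⟩ := exists_norm_sub_center_le hτ hτ' hδ₀
  have hmeas := aestronglyMeasurable_trace hτ hf.1.1
  rw [memLp_two_iff_integrable_sq_norm hmeas]
  refine Integrable.mono' (Integrable.add (integrable_const (2 * ‖f ((Real.pi / 2 : ℝ) : ℂ)‖ ^ 2))
    ((integrableOn_Ioo_rhombusMargin_rpow hτ hδ₁).const_mul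
      (2 * (K * bergmanNorm Θ δ (deriv f)) ^ 2))) (hmeas.norm.pow 2) ?_
  filter_upwards [ae_restrict_mem measurableSet_Ioo] with x hx
  have hx' := ofReal_mem_rhombus hτ hx
  rw [Real.norm_of_nonneg (by positivity)]
  exact sq_norm_le_of_norm_sub_le ((mem_rhombus_iff hτ).1 hx') (hK f hf _ hx')

theorem exists_traceNorm_le {Θ δ : ℝ} (hτ : 0 < Real.tan Θ) (hτ' : Real.tan Θ ≤ 1) (hδ₀ : 0 < δ)
    (hδ₁ : δ < 1) : ∃ C : ℝ, 0 < C ∧ ∀ f ∈ bergmanSobolev Θ δ,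
      traceNorm f ≤ C * (‖f ((Real.pi / 2 : ℝ) : ℂ)‖ + bergmanNorm Θ δ (deriv f)) := by
  obtain ⟨K, -, hK⟩ := exists_norm_sub_center_le hτ hτ' hδ₀
  have hI := integrableOn_Ioo_rhombusMargin_rpow hτ hδ₁
  set I := ∫ x : ℝ in Set.Ioo 0 Real.pi, rhombusMargin Θ x ^ (-δ) with hI_def
  have hI0 : 0 ≤ I := setIntegral_nonneg measurableSet_Ioo fun x hx =>
    Real.rpow_nonneg ((mem_rhombus_iff hτ).1 (ofReal_mem_rhombus hτ hx)).le _
  refine ⟨Real.sqrt (2 * Real.pi) + Real.sqrt (2 * K ^ 2 * I) + 1, by positivity, fun f hf => ?_⟩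
  refine le_mul_add_of_sq_le (norm_nonneg _) (bergmanNorm_nonneg _ _ _)
    (by have := Real.pi_pos; positivity) (by positivity) ?_
  have hle := setIntegral_mono_on
    ((memLp_two_iff_integrable_sq_norm (aestronglyMeasurable_trace hτ hf.1.1)).1
      (memLp_trace hτ hτ' hδ₀ hδ₁ hf))
    (Integrable.add (integrable_const (2 * ‖f ((Real.pi / 2 : ℝ) : ℂ)‖ ^ 2))
      (hI.const_mul (2 * (K * bergmanNorm Θ δ (deriv f)) ^ 2))) measurableSet_Ioo
    fun x hx => sq_norm_le_of_norm_sub_le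
      ((mem_rhombus_iff hτ).1 (ofReal_mem_rhombus hτ hx)) (hK f hf _ (ofReal_mem_rhombus hτ hx))
  simp only [Pi.add_apply] at hle
  rw [← sq_traceNorm, integral_add (integrable_const _) (hI.const_mul _), setIntegral_const,
    Real.volume_real_Ioo_of_le Real.pi_pos.le, smul_eq_mul, integral_const_mul, ← hI_def] at hle
  refine hle.trans (le_of_eq ?_)
  ring

theorem exists_norm_center_le_traceNorm {Θ δ : ℝ} (hτ : 0 < Real.tan Θ) (hτ' : Real.tan Θ ≤ 1)
    (hδ₀ : 0 < δ) (hδ₁ : δ < 1) : ∃ C : ℝ, 0 < C ∧ ∀ f ∈ bergmanSobolev Θ δ,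
      ‖f ((Real.pi / 2 : ℝ) : ℂ)‖ ≤ C * (traceNorm f + bergmanNorm Θ δ (deriv f)) := by
  have hpi := Real.pi_pos
  obtain ⟨K, -, hK⟩ := exists_norm_sub_center_le hτ hτ' hδ₀
  have hI := integrableOn_Ioo_rhombusMargin_rpow hτ hδ₁
  set I := ∫ x : ℝ in Set.Ioo 0 Real.pi, rhombusMargin Θ x ^ (-δ) with hI_def
  have hI0 : 0 ≤ I := setIntegral_nonneg measurableSet_Ioo fun x hx =>
    Real.rpow_nonneg ((mem_rhombus_iff hτ).1 (ofReal_mem_rhombus hτ hx)).le _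
  refine ⟨Real.sqrt (2 / Real.pi) + Real.sqrt (2 * K ^ 2 * I / Real.pi) + 1, by positivity,
    fun f hf => ?_⟩
  refine le_mul_add_of_sq_le (traceNorm_nonneg _) (bergmanNorm_nonneg _ _ _)
    (by positivity) (by positivity) ?_
  have hf2 := (memLp_two_iff_integrable_sq_norm (aestronglyMeasurable_trace hτ hf.1.1)).1
      (memLp_trace hτ hτ' hδ₀ hδ₁ hf)
  have hle := setIntegral_mono_on (integrableOn_const (C := ‖f ((Real.pi / 2 : ℝ) : ℂ)‖ ^ 2)
      (by simp))
    (Integrable.add (hf2.const_mul 2)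
      (hI.const_mul (2 * (K * bergmanNorm Θ δ (deriv f)) ^ 2))) measurableSet_Ioo
    fun x hx => sq_norm_le_of_norm_sub_le
      ((mem_rhombus_iff hτ).1 (ofReal_mem_rhombus hτ hx))
      ((norm_sub_rev _ _).le.trans (hK f hf _ (ofReal_mem_rhombus hτ hx)))
  simp only [Pi.add_apply] at hle
  rw [integral_add (hf2.const_mul 2) (hI.const_mul _), integral_const_mul,
    integral_const_mul, ← sq_traceNorm,
    ← hI_def, setIntegral_const, Real.volume_real_Ioo_of_le Real.pi_pos.le, smul_eq_mul] at hle
  rw [sub_zero, ← le_div_iff₀' hpi] at hle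
  refine hle.trans (le_of_eq ?_)
  field_simp

/-- The difference between π f(π/2) and the integral of f is an integrated oscillation, so only the
first power m^(-δ/2) has to be integrated. -/
theorem exists_norm_center_le_integral {Θ δ : ℝ} (hτ : 0 < Real.tan Θ) (hτ' : Real.tan Θ ≤ 1)
    (hδ₀ : 0 < δ) (hδ₁ : δ < 1) : ∃ C : ℝ, 0 < C ∧ ∀ f ∈ bergmanSobolev Θ δ,
      ‖f ((Real.pi / 2 : ℝ) : ℂ)‖ ≤
        C * (bergmanNorm Θ δ (deriv f) + ‖∫ x in Set.Ioo 0 Real.pi, f (x : ℂ)‖) := by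
  have hpi := Real.pi_pos
  obtain ⟨K, hK0, hK⟩ := exists_norm_sub_center_le hτ hτ' hδ₀
  have hI := integrableOn_Ioo_rhombusMargin_rpow (a := δ / 2) hτ (by linarith)
  set I := ∫ x : ℝ in Set.Ioo 0 Real.pi, rhombusMargin Θ x ^ (-(δ / 2)) with hI_def
  have hI0 : 0 ≤ I := setIntegral_nonneg measurableSet_Ioo fun x hx =>
    Real.rpow_nonneg ((mem_rhombus_iff hτ).1 (ofReal_mem_rhombus hτ hx)).le _
  refine ⟨(K * I + 1) / Real.pi, by positivity, fun f hf => ?_⟩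
  have hN := bergmanNorm_nonneg Θ δ (deriv f)
  set N := bergmanNorm Θ δ (deriv f)
  set v := f ((Real.pi / 2 : ℝ) : ℂ)
  have hfi : IntegrableOn (fun x : ℝ => f (x : ℂ)) (Set.Ioo 0 Real.pi) :=
    (memLp_trace hτ hτ' hδ₀ hδ₁ hf).integrable one_le_two
  have h1 : ‖∫ x in Set.Ioo 0 Real.pi, (f (x : ℂ) - v)‖ ≤ K * N * I := by
    rw [hI_def, ← integral_const_mul]
    refine norm_integral_le_of_norm_le (hI.const_mul (K * N)) ?_
    filter_upwards [ae_restrict_mem measurableSet_Ioo] with x hx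
    exact hK f hf _ (ofReal_mem_rhombus hτ hx)
  rw [integral_sub hfi (integrable_const v), setIntegral_const,
    Real.volume_real_Ioo_of_le hpi.le, sub_zero] at h1
  have h2 : Real.pi * ‖v‖ ≤ ‖∫ x in Set.Ioo 0 Real.pi, f (x : ℂ)‖ + K * N * I := by
    have h3 : ‖Real.pi • v‖ = Real.pi * ‖v‖ := by
      rw [norm_smul, Real.norm_of_nonneg hpi.le]
    rw [← h3]
    have h4 := norm_sub_norm_le (Real.pi • v) (∫ x in Set.Ioo 0 Real.pi, f (x : ℂ))
    rw [norm_sub_rev] at h4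
    linarith
  rw [div_mul_eq_mul_div, le_div_iff₀' hpi]
  nlinarith [mul_nonneg (mul_nonneg hK0.le hI0)
    (norm_nonneg (∫ x in Set.Ioo 0 Real.pi, f (x : ℂ)))]

theorem exists_bergmanNorm_le {Θ δ : ℝ} (hτ : 0 < Real.tan Θ) (hτ' : Real.tan Θ ≤ 1)
    (hδ₀ : 0 < δ) (hδ₁ : δ < 1) : ∃ C : ℝ, 0 < C ∧ ∀ f ∈ bergmanSobolev Θ δ,
      bergmanNorm Θ δ f ≤ C * (‖f ((Real.pi / 2 : ℝ) : ℂ)‖ + bergmanNorm Θ δ (deriv f)) := by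
  obtain ⟨K, -, hK⟩ := exists_norm_sub_center_le hτ hτ' hδ₀
  have hpi := Real.pi_pos
  have hJ := integrableOn_rhombus_rhombusMargin_rpow hτ hτ' hδ₁
  set J := ∫ s in rhombus Θ, rhombusMargin Θ s ^ (-δ) with hJ_def
  have hJ0 : 0 ≤ J := setIntegral_nonneg (isOpen_rhombus Θ).measurableSet fun s hs =>
    Real.rpow_nonneg ((mem_rhombus_iff hτ).1 hs).le _
  set W : ℝ := (2 * Real.pi) ^ δ * (2 * Real.pi) ^ δ with hW
  have hW0 : 0 < W := by positivity
  set V := volume.real (rhombus Θ) with hV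
  refine ⟨Real.sqrt (2 * W * V) + Real.sqrt (2 * W * K ^ 2 * J) + 1, by positivity,
    fun f hf => ?_⟩
  refine le_mul_add_of_sq_le (norm_nonneg _) (bergmanNorm_nonneg _ _ _)
    (by positivity) (by positivity) ?_
  have hc : IntegrableOn (fun _ : ℂ => 2 * ‖f ((Real.pi / 2 : ℝ) : ℂ)‖ ^ 2) (rhombus Θ) :=
    integrableOn_const (volume_rhombus_lt_top hτ hτ').ne
  have hle := setIntegral_mono_on hf.1.2
    ((Integrable.add hc
      (hJ.const_mul (2 * (K * bergmanNorm Θ δ (deriv f)) ^ 2))).mul_const W)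
    (isOpen_rhombus Θ).measurableSet
    fun s hs => mul_le_mul (sq_norm_le_of_norm_sub_le
      ((mem_rhombus_iff hτ).1 hs) (hK f hf _ hs)) (rhoWeight_le hτ hτ' hδ₀.le hs)
      (rhoWeight_nonneg δ s)
      (add_nonneg (by positivity) (mul_nonneg (by positivity)
        (Real.rpow_nonneg ((mem_rhombus_iff hτ).1 hs).le (-δ))))
  rw [← sq_bergmanNorm, integral_mul_const] at hle
  simp only [Pi.add_apply] at hle
  rw [integral_add hc (hJ.const_mul _), setIntegral_const, ← hV, smul_eq_mul,
    integral_const_mul, ← hJ_def] at hle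
  refine hle.trans (le_of_eq ?_)
  ring

theorem exists_norm_center_le_bergmanNorm {Θ δ : ℝ} (hτ : 0 < Real.tan Θ) (hτ' : Real.tan Θ ≤ 1)
    (hδ₀ : 0 ≤ δ) : ∃ C : ℝ, 0 < C ∧ ∀ f ∈ bergman Θ δ,
      ‖f ((Real.pi / 2 : ℝ) : ℂ)‖ ≤ C * bergmanNorm Θ δ f := by
  obtain ⟨A, hA, hAb⟩ := exists_norm_le_rhombusMargin_rpow_mul_bergmanNorm hτ hτ' hδ₀
  have hc := center_mem_rhombus hτ
  have h0 := (mem_rhombus_iff hτ).1 hc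
  exact ⟨_, by positivity, fun f hf => hAb f hf _ hc⟩

/-! ### Norm axioms -/

theorem eqOn_zero_of_bergmanNorm_eq_zero {Θ δ : ℝ} (hτ : 0 < Real.tan Θ) (hτ' : Real.tan Θ ≤ 1)
    (hδ₀ : 0 ≤ δ) {f : ℂ → ℂ} (hf : f ∈ bergman Θ δ) (h : bergmanNorm Θ δ f = 0) :
    Set.EqOn f 0 (rhombus Θ) := by
  obtain ⟨A, -, hAb⟩ := exists_norm_le_rhombusMargin_rpow_mul_bergmanNorm hτ hτ' hδ₀
  intro s hs
  have := hAb f hf s hs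
  rw [h, mul_zero] at this
  simpa using this

theorem sqrt_integral_sq_norm_add_le {α : Type*} [MeasurableSpace α] {μ : Measure α} {f g : α → ℂ}
    (hf : MemLp f 2 μ) (hg : MemLp g 2 μ) :
    Real.sqrt (∫ x, ‖f x + g x‖ ^ 2 ∂μ) ≤
      Real.sqrt (∫ x, ‖f x‖ ^ 2 ∂μ) + Real.sqrt (∫ x, ‖g x‖ ^ 2 ∂μ) := by
  have key : ∀ h : α → ℂ, MemLp h 2 μ →
      eLpNorm h 2 μ = ENNReal.ofReal (Real.sqrt (∫ x, ‖h x‖ ^ 2 ∂μ)) := fun h hh => by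
    rw [hh.eLpNorm_eq_integral_rpow_norm two_ne_zero ENNReal.ofNat_ne_top, Real.sqrt_eq_rpow]
    simp
  have h := eLpNorm_add_le hf.1 hg.1 one_le_two
  rw [key _ hf, key _ hg, key _ (hf.add hg),
    ← ENNReal.ofReal_add (Real.sqrt_nonneg _) (Real.sqrt_nonneg _)] at h
  exact (ENNReal.ofReal_le_ofReal_iff (by positivity)).1 h

theorem traceNorm_smul (c : ℂ) (f : ℂ → ℂ) : traceNorm (c • f) = ‖c‖ * traceNorm f := by
  simp only [traceNorm, Pi.smul_apply, norm_smul, mul_pow]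
  rw [integral_const_mul, Real.sqrt_mul (by positivity), Real.sqrt_sq (norm_nonneg _)]

theorem bergmanNorm_smul (Θ δ : ℝ) (c : ℂ) (f : ℂ → ℂ) :
    bergmanNorm Θ δ (c • f) = ‖c‖ * bergmanNorm Θ δ f := by
  simp only [bergmanNorm, Pi.smul_apply, norm_smul, mul_pow, mul_assoc]
  rw [integral_const_mul, Real.sqrt_mul (by positivity), Real.sqrt_sq (norm_nonneg _)]

/-- Needed because differentiation is known to be linear only on the rhombus, the functions being
arbitrary elsewhere. -/
theorem bergmanNorm_congr {Θ δ : ℝ} {f g : ℂ → ℂ} (h : Set.EqOn f g (rhombus Θ)) :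
    bergmanNorm Θ δ f = bergmanNorm Θ δ g := by
  unfold bergmanNorm
  congr 1
  refine setIntegral_congr_fun (isOpen_rhombus Θ).measurableSet fun s hs => ?_
  simp only [h hs]

/-- Multiplication by the square root of the weight is an isometry into unweighted L², where
Minkowski's inequality applies. -/
theorem bergmanNorm_add_le {Θ δ : ℝ} {f g : ℂ → ℂ} (hf : f ∈ bergman Θ δ)
    (hg : g ∈ bergman Θ δ) :
    bergmanNorm Θ δ (f + g) ≤ bergmanNorm Θ δ f + bergmanNorm Θ δ g := by
  set w : ℂ → ℂ := fun s => (Real.sqrt (rhoWeight δ s) : ℂ) with hw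
  have hwm : Measurable w := by
    have := measurable_rhoWeight δ
    fun_prop
  have hsq : ∀ (h : ℂ → ℂ) s, ‖h s * w s‖ ^ 2 = ‖h s‖ ^ 2 * rhoWeight δ s := fun h s => by
    rw [norm_mul, mul_pow, hw, Complex.norm_real, Real.norm_of_nonneg (Real.sqrt_nonneg _),
      Real.sq_sqrt (rhoWeight_nonneg δ s)]
  have hmem : ∀ h ∈ bergman Θ δ,
      MemLp (fun s => h s * w s) 2 (volume.restrict (rhombus Θ)) := fun h hh => by
    have hm : AEStronglyMeasurable (fun s => h s * w s) (volume.restrict (rhombus Θ)) :=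
      (hh.1.continuousOn.aestronglyMeasurable (isOpen_rhombus Θ).measurableSet).mul
        hwm.aestronglyMeasurable
    rw [memLp_two_iff_integrable_sq_norm hm]
    simp only [hsq]
    exact hh.2
  have h := sqrt_integral_sq_norm_add_le (hmem f hf) (hmem g hg)
  simp only [← add_mul, hsq] at h
  have h3 : ∀ s, ‖(f s + g s) * w s‖ ^ 2 = ‖(f + g) s‖ ^ 2 * rhoWeight δ s := hsq (f + g)
  simp only [h3] at h
  exact h

/-! ### Assembly of the theorem -/

theorem proposition9p2 (Θ δ : ℝ) (hΘ₀ : 0 < Θ) (hΘ₁ : Θ < Real.pi / 4)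
    (hδ₀ : 0 < δ) (hδ₁ : δ < 1) :
    -- traces on `(0, π)` are square integrable, hence integrable
    (∀ f ∈ bergmanSobolev Θ δ,
      MemLp (fun x : ℝ => f (x : ℂ)) 2 (volume.restrict (Set.Ioo 0 Real.pi)) ∧
      IntegrableOn (fun x : ℝ => f (x : ℂ)) (Set.Ioo 0 Real.pi)) ∧
    -- the Poincaré-type inequality
    (∃ C : ℝ, 0 < C ∧ ∀ f ∈ bergmanSobolev Θ δ,
      bergmanNorm Θ δ f ≤
        C * (bergmanNorm Θ δ (deriv f) + ‖∫ x in Set.Ioo 0 Real.pi, f (x : ℂ)‖)) ∧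
    -- `f ↦ ‖f'‖ + ‖f‖_{L²(0, π)}` is a norm
    (∃ p : Seminorm ℂ (bergmanSobolev Θ δ),
      (∀ f, p f = bergmanNorm Θ δ (deriv (f : ℂ → ℂ)) + traceNorm f) ∧
      ∀ f, p f = 0 → Set.EqOn (f : ℂ → ℂ) 0 (rhombus Θ)) ∧
    -- it is equivalent to `f ↦ ‖f‖ + ‖f'‖`
    (∃ c K : ℝ, 0 < c ∧ 0 < K ∧ ∀ f ∈ bergmanSobolev Θ δ,
      c * (bergmanNorm Θ δ f + bergmanNorm Θ δ (deriv f)) ≤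
        bergmanNorm Θ δ (deriv f) + traceNorm f ∧
      bergmanNorm Θ δ (deriv f) + traceNorm f ≤
        K * (bergmanNorm Θ δ f + bergmanNorm Θ δ (deriv f))) := by
  have hpi := Real.pi_pos
  have hτ : 0 < Real.tan Θ := Real.tan_pos_of_pos_of_lt_pi_div_two hΘ₀ (by linarith)
  have hτ' : Real.tan Θ ≤ 1 := by
    rw [← Real.tan_pi_div_four]
    exact (Real.tan_lt_tan_of_lt_of_lt_pi_div_two (by linarith) (by linarith) hΘ₁).le
  obtain ⟨C₁, hC₁, h₁⟩ := exists_bergmanNorm_le hτ hτ' hδ₀ hδ₁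
  obtain ⟨C₂, hC₂, h₂⟩ := exists_traceNorm_le hτ hτ' hδ₀ hδ₁
  obtain ⟨C₃, hC₃, h₃⟩ := exists_norm_center_le_traceNorm hτ hτ' hδ₀ hδ₁
  obtain ⟨C₄, hC₄, h₄⟩ := exists_norm_center_le_integral hτ hτ' hδ₀ hδ₁
  obtain ⟨C₅, hC₅, h₅⟩ := exists_norm_center_le_bergmanNorm (δ := δ) hτ hτ' hδ₀.le
  have hN : ∀ f, 0 ≤ bergmanNorm Θ δ f := bergmanNorm_nonneg Θ δ
  -- This passes through the centre: ‖f‖ is bounded by |f(π/2)| + ‖f'‖, and |f(π/2)| by the trace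
  -- norm plus ‖f'‖. It gives both definiteness and the lower half of the equivalence.
  have hlower : ∀ f ∈ bergmanSobolev Θ δ,
      bergmanNorm Θ δ f ≤ C₁ * (C₃ + 1) * (bergmanNorm Θ δ (deriv f) + traceNorm f) := by
    intro f hf
    rw [mul_assoc]
    refine (h₁ f hf).trans (mul_le_mul_of_nonneg_left ?_ hC₁.le)
    linarith [h₃ f hf, traceNorm_nonneg f]
  refine ⟨fun f hf => ?_, ⟨C₁ * (C₄ + 1), by positivity, fun f hf => ?_⟩, ?_,
    ⟨(C₁ * (C₃ + 1) + 1)⁻¹, 1 + C₂ * (C₅ + 1), by positivity, by positivity,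
      fun f hf => ⟨?_, ?_⟩⟩⟩
  · have h := memLp_trace hτ hτ' hδ₀ hδ₁ hf
    exact ⟨h, h.integrable one_le_two⟩
  · rw [mul_assoc]
    refine (h₁ f hf).trans (mul_le_mul_of_nonneg_left ?_ hC₁.le)
    linarith [h₄ f hf, norm_nonneg (∫ x in Set.Ioo 0 Real.pi, f (x : ℂ))]
  · refine ⟨Seminorm.of (fun f => bergmanNorm Θ δ (deriv (f : ℂ → ℂ)) + traceNorm f)
      (fun f g => ?_) (fun c f => ?_), fun f => rfl, fun f hf => ?_⟩
    · have hd : Set.EqOn (deriv ((f + g : bergmanSobolev Θ δ) : ℂ → ℂ))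
          (deriv (f : ℂ → ℂ) + deriv (g : ℂ → ℂ)) (rhombus Θ) := fun s hs => by
        have hn := (isOpen_rhombus Θ).mem_nhds hs
        exact deriv_add (f.2.1.1.differentiableAt hn) (g.2.1.1.differentiableAt hn)
      have h1 := bergmanNorm_add_le f.2.2 g.2.2
      have h2 : traceNorm ((f + g : bergmanSobolev Θ δ) : ℂ → ℂ) ≤ traceNorm f + traceNorm g :=
        sqrt_integral_sq_norm_add_le (memLp_trace hτ hτ' hδ₀ hδ₁ f.2)
          (memLp_trace hτ hτ' hδ₀ hδ₁ g.2)
      rw [bergmanNorm_congr hd]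
      linarith
    · have hd : Set.EqOn (deriv ((c • f : bergmanSobolev Θ δ) : ℂ → ℂ))
          (c • deriv (f : ℂ → ℂ)) (rhombus Θ) := fun s hs =>
        deriv_const_smul c (f.2.1.1.differentiableAt ((isOpen_rhombus Θ).mem_nhds hs))
      rw [bergmanNorm_congr hd, bergmanNorm_smul, Submodule.coe_smul, traceNorm_smul, mul_add]
    · change bergmanNorm Θ δ (deriv (f : ℂ → ℂ)) + traceNorm f = 0 at hf
      have h := hlower f f.2
      rw [hf, mul_zero] at h
      exact eqOn_zero_of_bergmanNorm_eq_zero hτ hτ' hδ₀.le f.2.1 (le_antisymm h (hN _))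
  · rw [inv_mul_le_iff₀ (by positivity)]
    linarith [hlower f hf, traceNorm_nonneg f]
  -- Through the centre again, now with |f(π/2)| ≤ C₅ ‖f‖ by point evaluation.
  · have h := (h₂ f hf).trans (mul_le_mul_of_nonneg_left (add_le_add_left (h₅ f hf.1) _) hC₂.le)
    nlinarith [hN f, hN (deriv f), mul_nonneg hC₂.le (hN f),
      mul_nonneg (mul_nonneg hC₂.le hC₅.le) (hN (deriv f))]
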